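/- **Theorem (stochastic min-max equality).** Let $S\subseteq\mathbb R^d$ be closed and convex, let $V$ be a convex neighborhood of $S$ (i.e. $V$ is convex and $S\subseteq \operatorname{int} V$), let $\mathcal A$ be a set of probability distributions on a measurable space $\Xi$, and let $\varphi:\mathbb R^d\times\Xi\to\mathbb R$. Write $g(x,P):=\mathbb E_P[\varphi(x,\xi)]$ and $f(x):=\sup_{P\in\mathcal A}g(x,P)$. Consider the assumptions * (A1) for all $x\in V$ and $P\in\mathcal A$ the function $\xi\mapsto\varphi(x,\xi)$ is measurable and $P$-integrable; * (A2) for all $\xi\in\Xi$ the function $x\mapsto\varphi(x,\xi)$ is convex on $V$; * (A3) $f(x)<+\infty$ for all $x\in V$. Let $\bar x\in S$ be an optimal solution of $\inf_{x\in S}\sup_{P\in\mathcal A}g(x,P)$, i.e. $f(\bar x)\le f(x)$ for all $x\in S$. **(I)** Assume that $\mathcal A$ is nonempty and convex, that (A1)–(A3) hold, and that $\mathcal A$ carries a topology $\mathcal T$ for which $\mathcal A$ is sequentially compact (B1) and, for every $x\in V$, the map $P\mapsto g(x,P)$ is continuous on $\mathcal A$ (B2). Then there exists $\bar P\in\mathcal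 A$ such that $(\bar x,\bar P)$ is a saddle point, i.e. $$g(\bar x,P)\le g(\bar x,\bar P)\le g(x,\bar P)\qquad\text{for all }x\in S,\ P\in\mathcal A,$$ and the minimax equality $$\inf_{x\in S}\sup_{P\in\mathcal A}g(x,P)=\sup_{P\in\mathcal A}\inf_{x\in S}g(x,P)$$ holds (in the extended reals). **(II)** Let $\Xi=\Xi_1\times\cdots\times\Xi_n$, where each $(\Xi_k,\rho_k)$ is a proper metric space (closed bounded sets are compact), with the Borel $\sigma$-algebra, and let $\rho$ be a metric on $\Xi$ that is equivalent (bounded above and below by positive multiples) to the product metric $(\sum_k\rho_k^q)^{1/q}$ for some $q\in[1,\infty]$. Let $p\ge1$, $\varepsilon_1,\dots,\varepsilon_n\ge0$, let $Q$ be a probability distribution on $\Xi$ with finite $p$-th moment with respect to $\rho$, and let $\mathcal A=\mathcal T_p(Q,\varepsilon)$ be the multi-transport hyperrectangle, i.e. the set of the second marginals of all probability distributions $\pi$ on $\Xi\times\Xi$ with first marginal $Q$ and $\int\rho_k(\zeta_k,\xi_k)^p\,d\pi(\zeta,\xi)\le\varepsilon_k^p$ for all $k$. Assume that there is $r\in[0,p)$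 such that for each $x\in V$ the function $\xi\mapsto\varphi(x,\xi)$ is continuous and has growth of order $r$, i.e. both $h=\varphi(x,\cdot)$ and $h=-\varphi(x,\cdot)$ satisfy $h(\xi)\le C(1+\rho(\zeta,\xi)^r)$ for all $\xi\in\Xi$, for some $C>0$ and $\zeta\in\Xi$ (which may depend on $x$ and on the sign). Assume also (A1)–(A3). Then the conclusion of (I) holds: there is $\bar P\in\mathcal A$ such that $(\bar x,\bar P)$ is a saddle point, and the minimax equality holds. -/

import Mathlib

open MeasureTheory Topology
open scoped ENNReal NNReal

noncomputable section

/-- The expected cost `g(x, P) = E_P[φ(x, ξ)]`. -/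
def expectedCost {E Ξ : Type*} [MeasurableSpace Ξ] (φ : E → Ξ → ℝ)
    (x : E) (P : ProbabilityMeasure Ξ) : ℝ :=
  ∫ ξ, φ x ξ ∂(P : Measure Ξ)

/-- The worst-case cost `f(x) = sup_{P ∈ A} g(x, P)`, as an extended real. -/
def worstCaseCost {E Ξ : Type*} [MeasurableSpace Ξ] (A : Set (ProbabilityMeasure Ξ))
    (φ : E → Ξ → ℝ) (x : E) : EReal :=
  ⨆ P ∈ A, (expectedCost φ x P : EReal)

/-- A set of probability distributions is convex if it is closed under mixtures
`a • P + b • Q` with `a, b ≥ 0`, `a + b = 1`. -/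
def IsConvexAmbiguitySet {Ξ : Type*} [MeasurableSpace Ξ]
    (A : Set (ProbabilityMeasure Ξ)) : Prop :=
  Convex ℝ≥0 ((fun P : ProbabilityMeasure Ξ => (P : Measure Ξ)) '' A)

/-- The integrability, convexity and finiteness assumptions on the integrand `φ` over `V`
and the ambiguity set `A`. -/
structure IsSaddleFunction {d : ℕ} {Ξ : Type*} [MeasurableSpace Ξ]
    (A : Set (ProbabilityMeasure Ξ)) (V : Set (EuclideanSpace ℝ (Fin d)))
    (φ : EuclideanSpace ℝ (Fin d) → Ξ → ℝ) : Prop where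
  measurable : ∀ x ∈ V, Measurable (φ x)
  integrable : ∀ x ∈ V, ∀ P ∈ A, Integrable (φ x) (P : Measure Ξ)
  convexOn : ∀ ξ, ConvexOn ℝ V (fun x => φ x ξ)
  finite : ∀ x ∈ V, worstCaseCost A φ x < ⊤

/-- `x` is an optimal solution of `inf_{x ∈ S} sup_{P ∈ A} E_P[φ(x, ξ)]`. -/
def IsOptimalSolution {E Ξ : Type*} [MeasurableSpace Ξ] (A : Set (ProbabilityMeasure Ξ))
    (S : Set E) (φ : E → Ξ → ℝ) (x : E) : Prop :=
  x ∈ S ∧ IsMinOn (worstCaseCost A φ) S x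

/-- The minimax equality `inf_{x ∈ S} sup_{P ∈ A} g(x, P) = sup_{P ∈ A} inf_{x ∈ S} g(x, P)`,
in the extended reals. -/
def MinimaxEquality {E Ξ : Type*} [MeasurableSpace Ξ] (A : Set (ProbabilityMeasure Ξ))
    (S : Set E) (φ : E → Ξ → ℝ) : Prop :=
  (⨅ x ∈ S, ⨆ P ∈ A, (expectedCost φ x P : EReal)) =
    ⨆ P ∈ A, ⨅ x ∈ S, (expectedCost φ x P : EReal)

/-- `ρ` is a metric on `X`. -/
structure IsMetric {X : Type*} (ρ : X → X → ℝ) : Prop where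
  eq_zero_iff : ∀ x y, ρ x y = 0 ↔ x = y
  symm : ∀ x y, ρ x y = ρ y x
  triangle : ∀ x y z, ρ x z ≤ ρ x y + ρ y z

/-- `ρ` is (strongly) equivalent to the product metric `(∑ₖ ρₖ ^ q) ^ (1 / q)`
(the maximum of the `ρₖ` if `q = ∞`), which is the metric of `PiLp q Ξ`. -/
def IsEquivProductMetric {n : ℕ} {Ξ : Fin n → Type*} [∀ k, MetricSpace (Ξ k)]
    (q : ℝ≥0∞) [Fact (1 ≤ q)] (ρ : (∀ k, Ξ k) → (∀ k, Ξ k) → ℝ) : Prop :=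
  ∃ c > 0, ∃ C > 0, ∀ ζ ξ : ∀ k, Ξ k,
    c * dist (WithLp.toLp q ζ : PiLp q Ξ) (WithLp.toLp q ξ) ≤ ρ ζ ξ ∧
      ρ ζ ξ ≤ C * dist (WithLp.toLp q ζ : PiLp q Ξ) (WithLp.toLp q ξ)

/-- `P` has finite `p`-th moment with respect to the metric `ρ`. -/
def HasFiniteMoment {X : Type*} [MeasurableSpace X] (ρ : X → X → ℝ) (p : ℝ)
    (P : ProbabilityMeasure X) : Prop :=
  ∃ ζ, ∫⁻ ξ, ENNReal.ofReal (ρ ζ ξ ^ p) ∂(P : Measure X) < ∞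

/-- The class of functions with one-sided growth `h(ξ) ≤ C (1 + ρ(ζ, ξ) ^ r)`. -/
def growthClassUp {X : Type*} (ρ : X → X → ℝ) (r : ℝ) : Set (X → ℝ) :=
  {h | ∃ C > 0, ∃ ζ, ∀ ξ, h ξ ≤ C * (1 + ρ ζ ξ ^ r)}

/-- The class of functions with growth of order `r` on both sides. -/
def growthClass {X : Type*} (ρ : X → X → ℝ) (r : ℝ) : Set (X → ℝ) :=
  {h | h ∈ growthClassUp ρ r ∧ -h ∈ growthClassUp ρ r}

/-- The multi-transport hyperrectangle: the second marginals of the distributions on `Ξ × Ξ` with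
first marginal `Q` and `k`-th transport cost at most `εₖ ^ p` for every `k`. -/
def multiTransportHyperrectangle {n : ℕ} {Ξ : Fin n → Type*} [∀ k, MetricSpace (Ξ k)]
    [∀ k, MeasurableSpace (Ξ k)] (p : ℝ) (Q : ProbabilityMeasure (∀ k, Ξ k))
    (ε : Fin n → ℝ≥0) : Set (ProbabilityMeasure (∀ k, Ξ k)) :=
  {P | ∃ π : ProbabilityMeasure ((∀ k, Ξ k) × (∀ k, Ξ k)),
    (π : Measure ((∀ k, Ξ k) × (∀ k, Ξ k))).map Prod.fst = (Q : Measure (∀ k, Ξ k)) ∧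
    (π : Measure ((∀ k, Ξ k) × (∀ k, Ξ k))).map Prod.snd = (P : Measure (∀ k, Ξ k)) ∧
    ∀ k, ∫⁻ z, edist (z.1 k) (z.2 k) ^ p
      ∂(π : Measure ((∀ k, Ξ k) × (∀ k, Ξ k))) ≤ (ε k : ℝ≥0∞) ^ p}

end

section SaddlePoints

open Filter

/-! Let m be the optimal value, finite by (A3) and nonemptiness. Everything reduces to one P̄ in `A`
with g(x, P̄) ≥ m for all x in `S`: since g(x̄, P) ≤ m for all P, this gives both the saddle point
and the minimax equality.

For finitely many points of `S`, such a P exists by separation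
(`exists_mem_forall_le_expectedCost`): otherwise a hyperplane separates the compact convex set of
cost vectors from an orthant, and its normalized coefficients average the points into a decision
with worst-case cost below m. Taking the first j terms of a dense sequence in `S` and a limit along
a subsequence covers the whole sequence; continuity of the convex function g(·, P̄) on the interior
of `V` covers `S`.

The topology on `A` matters only through `IsCostSeqCompact`. For hyperrectangles this follows from
Prokhorov's theorem applied to the couplings: moment bounds give tightness, transport costs are
lower semicontinuous, and r < p gives the uniform integrability that carries expected costs to the
limit. -/

/-- Every sequence in `A` has a subsequence along which the expected costs converge, for all
decisions in `V`, to those of an element of `A`. -/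
def IsCostSeqCompact {E Ξ : Type*} [MeasurableSpace Ξ] (A : Set (ProbabilityMeasure Ξ))
    (V : Set E) (φ : E → Ξ → ℝ) : Prop :=
  ∀ u : ℕ → ProbabilityMeasure Ξ, (∀ j, u j ∈ A) → ∃ P ∈ A, ∃ ψ : ℕ → ℕ, StrictMono ψ ∧
    ∀ x ∈ V, Tendsto (fun j => expectedCost φ x (u (ψ j))) atTop (𝓝 (expectedCost φ x P))

/-! ### Minimax by separation and a limit over a dense sequence. -/

section Minimax

variable {d : ℕ} {Ξ : Type*} [MeasurableSpace Ξ] {A : Set (ProbabilityMeasure Ξ)}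
  {S V : Set (EuclideanSpace ℝ (Fin d))} {φ : EuclideanSpace ℝ (Fin d) → Ξ → ℝ}

theorem IsSaddleFunction.convexOn_expectedCost (h : IsSaddleFunction A V φ)
    (hV : Convex ℝ V) {P : ProbabilityMeasure Ξ} (hP : P ∈ A) :
    ConvexOn ℝ V (fun x => expectedCost φ x P) := by
  refine ⟨hV, fun x hx y hy a b ha hb hab => ?_⟩
  have hxi := h.integrable x hx P hP
  have hyi := h.integrable y hy P hP
  have hzi := h.integrable _ (hV hx hy ha hb hab) P hP
  simp only [expectedCost, smul_eq_mul]
  rw [← integral_const_mul, ← integral_const_mul,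
    ← integral_add (hxi.const_mul a) (hyi.const_mul b)]
  exact integral_mono hzi ((hxi.const_mul a).add (hyi.const_mul b))
    fun ξ => (h.convexOn ξ).2 hx hy ha hb hab

theorem IsConvexAmbiguitySet.exists_expectedCost_eq (hA : IsConvexAmbiguitySet A)
    (h : IsSaddleFunction A V φ) {P Q : ProbabilityMeasure Ξ} (hP : P ∈ A) (hQ : Q ∈ A)
    {a b : ℝ} (ha : 0 ≤ a) (hb : 0 ≤ b) (hab : a + b = 1) :
    ∃ R ∈ A, ∀ x ∈ V, expectedCost φ x R = a * expectedCost φ x P + b * expectedCost φ x Q := by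
  lift a to ℝ≥0 using ha
  lift b to ℝ≥0 using hb
  obtain ⟨R, hR, hRe⟩ := hA ⟨P, hP, rfl⟩ ⟨Q, hQ, rfl⟩ (zero_le (a := a)) (zero_le (a := b))
    (by exact_mod_cast hab)
  refine ⟨R, hR, fun x hx => ?_⟩
  simp only at hRe
  rw [expectedCost, hRe, integral_add_measure, integral_smul_nnreal_measure,
    integral_smul_nnreal_measure]
  · rfl
  · exact (h.integrable x hx P hP).smul_measure_nnreal
  · exact (h.integrable x hx Q hQ).smul_measure_nnreal

theorem IsCostSeqCompact.isCompact_image {ι : Type*} [Fintype ι] {E : Type*} {V : Set E}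
    {φ : E → Ξ → ℝ} (hA : IsCostSeqCompact A V φ) {y : ι → E} (hy : ∀ i, y i ∈ V) :
    IsCompact ((fun P i => expectedCost φ (y i) P) '' A) := by
  refine IsSeqCompact.isCompact fun u hu => ?_
  choose P hPA hPu using hu
  obtain ⟨R, hR, ψ, hψ, hlim⟩ := hA P hPA
  refine ⟨_, ⟨R, hR, rfl⟩, ψ, hψ, tendsto_pi_nhds.2 fun i => ?_⟩
  simpa [← hPu] using hlim (y i) (hy i)

/-- The finite-dimensional core: a strict Hahn–Banach separation of the cost vectors from the
orthant `{z | m ≤ z}`, followed by Jensen's inequality for g(·, P) with the coefficients of the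
functional as weights. -/
theorem exists_mem_forall_le_expectedCost {ι : Type*} [Fintype ι]
    (hS : Convex ℝ S) (hV : Convex ℝ V) (hSV : S ⊆ V)
    (hne : A.Nonempty) (hA : IsConvexAmbiguitySet A) (h : IsSaddleFunction A V φ)
    (hc : IsCostSeqCompact A V φ) {m : ℝ} (hm : ∀ x ∈ S, (m : EReal) ≤ worstCaseCost A φ x)
    {y : ι → EuclideanSpace ℝ (Fin d)} (hy : ∀ i, y i ∈ S) :
    ∃ P ∈ A, ∀ i, m ≤ expectedCost φ (y i) P := by
  classical
  by_contra! hcon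
  obtain ⟨P₀, hP₀⟩ := hne
  have hconv : Convex ℝ ((fun P i => expectedCost φ (y i) P) '' A) := by
    rintro _ ⟨P, hP, rfl⟩ _ ⟨Q, hQ, rfl⟩ a b ha hb hab
    obtain ⟨R, hR, hRe⟩ := hA.exists_expectedCost_eq h hP hQ ha hb hab
    exact ⟨R, hR, funext fun i => by simp [hRe _ (hSV (hy i))]⟩
  obtain ⟨f, u, v, hfu, huv, hvf⟩ := geometric_hahn_banach_compact_closed hconv
    (hc.isCompact_image fun i => hSV (hy i)) (convex_Ici (𝕜 := ℝ) (fun _ : ι => m)) isClosed_Ici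
    (Set.disjoint_left.2 fun z hz hz' => by
      obtain ⟨P, hP, rfl⟩ := hz
      obtain ⟨i, hi⟩ := hcon P hP
      exact absurd (hz' i) (not_le.2 hi))
  set c : ι → ℝ := fun i => f (Pi.single i 1)
  have hf : ∀ z : ι → ℝ, f z = ∑ i, c i * z i := fun z => by
    conv_lhs => rw [← Finset.univ_sum_single z, map_sum]
    refine Finset.sum_congr rfl fun i _ => ?_
    rw [show Pi.single i (z i) = z i • (Pi.single i 1 : ι → ℝ) by
      rw [← Pi.single_smul, smul_eq_mul, mul_one], map_smul, smul_eq_mul, mul_comm]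
  have hc0 : ∀ i, 0 ≤ c i := fun i => by
    by_contra! hi
    set K := f fun _ => m
    have hK : v < K := hvf _ (le_refl (fun _ : ι => m))
    -- If `c i < 0`, the functional can be lowered to exactly `v` inside the orthant by moving along
    -- coordinate `i`.
    have h1 : (0 : ι → ℝ) ≤ Pi.single i 1 := Pi.single_nonneg.2 zero_le_one
    have := hvf ((fun _ => m) + ((v - K) / c i) • Pi.single i 1) (by
      refine le_add_of_nonneg_right (smul_nonneg ?_ h1)
      exact div_nonneg_of_nonpos (by linarith) hi.le)
    rw [map_add, map_smul, smul_eq_mul, div_mul_cancel₀ _ hi.ne] at this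
    linarith
  set σ := ∑ i, c i
  have hK : v < m * σ := by
    have := hvf _ (le_refl (fun _ : ι => m))
    rwa [hf, ← Finset.sum_mul, mul_comm] at this
  -- Otherwise the functional vanishes, which forces 0 < u < v < 0.
  have hσ : 0 < σ := by
    refine (Finset.sum_nonneg fun i _ => hc0 i).lt_of_ne fun h0 => ?_
    have hz := (Finset.sum_eq_zero_iff_of_nonneg fun i _ => hc0 i).1 h0.symm
    have := hfu _ ⟨P₀, hP₀, rfl⟩
    rw [hf, Finset.sum_eq_zero fun i hi => by rw [hz i hi, zero_mul]] at this
    have h0' : σ = 0 := h0.symm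
    rw [h0', mul_zero] at hK
    linarith
  have hw : ∀ i ∈ Finset.univ, 0 ≤ c i / σ := fun i _ => div_nonneg (hc0 i) hσ.le
  have hw1 : ∑ i, c i / σ = 1 := by rw [← Finset.sum_div, div_self hσ.ne']
  have hxS : ∑ i, (c i / σ) • y i ∈ S := hS.sum_mem hw hw1 fun i _ => hy i
  -- The gap between `u` and `v` keeps the supremum over `A` strictly below m: it is at most `u /
  -- σ`, and u < v < mσ.
  refine absurd (hm _ hxS) (not_le.2 (lt_of_le_of_lt (b := ((u / σ : ℝ) : EReal)) ?_ ?_))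
  · refine iSup₂_le fun P hP => EReal.coe_le_coe_iff.2 ?_
    refine ((h.convexOn_expectedCost hV hP).map_sum_le hw hw1 fun i _ => hSV (hy i)).trans ?_
    have := hfu _ ⟨P, hP, rfl⟩
    rw [hf] at this
    rw [le_div_iff₀ hσ, Finset.sum_mul]
    refine le_trans (le_of_eq (Finset.sum_congr rfl fun i _ => ?_)) this.le
    rw [smul_eq_mul]
    field_simp
  · rw [EReal.coe_lt_coe_iff, div_lt_iff₀ hσ]
    linarith

theorem exists_isSaddlePointOn_of_isCostSeqCompact
    (hS : Convex ℝ S) (hV : Convex ℝ V) (hSV : V ∈ 𝓝ˢ S)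
    (hne : A.Nonempty) (hA : IsConvexAmbiguitySet A) (h : IsSaddleFunction A V φ)
    (hc : IsCostSeqCompact A V φ) {xbar : EuclideanSpace ℝ (Fin d)}
    (hx : IsOptimalSolution A S φ xbar) :
    (∃ Pbar ∈ A, IsSaddlePointOn S A (expectedCost φ) xbar Pbar) ∧ MinimaxEquality A S φ := by
  have hSi : S ⊆ interior V := subset_interior_iff_mem_nhdsSet.2 hSV
  have hSub : S ⊆ V := hSi.trans interior_subset
  obtain ⟨hxS, hmin⟩ := hx
  obtain ⟨P₀, hP₀⟩ := hne
  have htop : worstCaseCost A φ xbar ≠ ⊤ := (h.finite xbar (hSub hxS)).ne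
  have hbot : worstCaseCost A φ xbar ≠ ⊥ := fun hb => by
    have : (expectedCost φ xbar P₀ : EReal) ≤ worstCaseCost A φ xbar :=
      le_iSup₂_of_le P₀ hP₀ le_rfl
    rw [hb, le_bot_iff] at this
    exact EReal.coe_ne_bot _ this
  set m := (worstCaseCost A φ xbar).toReal
  have hm : (m : EReal) = worstCaseCost A φ xbar := EReal.coe_toReal htop hbot
  have hle : ∀ P ∈ A, expectedCost φ xbar P ≤ m := fun P hP => by
    rw [← EReal.coe_le_coe_iff, hm]
    exact le_iSup₂_of_le P hP le_rfl
  have key : ∃ P ∈ A, ∀ x ∈ S, m ≤ expectedCost φ x P := by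
    have : Nonempty S := ⟨⟨xbar, hxS⟩⟩
    obtain ⟨y, hy⟩ := TopologicalSpace.exists_dense_seq S
    have hfin : ∀ j : ℕ, ∃ P ∈ A, ∀ i : Fin j, m ≤ expectedCost φ (y i) P := fun j =>
      exists_mem_forall_le_expectedCost hS hV hSub ⟨P₀, hP₀⟩ hA h hc
        (fun x hx => hm.trans_le (hmin hx)) fun i => (y i).2
    choose u huA hu using hfin
    obtain ⟨P, hP, ψ, hψ, hlim⟩ := hc u huA
    have hcont : Continuous fun x : S => expectedCost φ x P :=
      continuousOn_iff_continuous_domRestrict.1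
        ((h.convexOn_expectedCost hV hP).continuousOn_interior.mono hSi)
    refine ⟨P, hP, fun x hx => hy.induction_on (p := fun x : S => m ≤ expectedCost φ x P)
      ⟨x, hx⟩ (isClosed_le continuous_const hcont) fun i => ?_⟩
    -- The measure `u (ψ j)` handles point `i` as soon as i < j ≤ ψ j.
    refine ge_of_tendsto (hlim (y i) (hSub (y i).2)) ?_
    filter_upwards [eventually_gt_atTop i] with j hj
    exact hu (ψ j) ⟨i, hj.trans_le hψ.le_apply⟩
  obtain ⟨P, hP, hPm⟩ := key
  refine ⟨⟨P, hP, fun x hx R hR => (hle R hR).trans (hPm x hx)⟩,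
    le_antisymm ?_ (iSup₂_iInf₂_le_iInf₂_iSup₂ S A fun x P => (expectedCost φ x P : EReal))⟩
  calc (⨅ x ∈ S, ⨆ P ∈ A, (expectedCost φ x P : EReal)) ≤ worstCaseCost A φ xbar :=
        iInf₂_le xbar hxS
    _ = m := hm.symm
    _ ≤ ⨅ x ∈ S, (expectedCost φ x P : EReal) :=
        le_iInf₂ fun x hx => EReal.coe_le_coe_iff.2 (hPm x hx)
    _ ≤ _ := le_iSup₂_of_le P hP le_rfl

theorem isCostSeqCompact_of_seqCompactSpace {E : Type*} {V : Set E} {φ : E → Ξ → ℝ}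
    [TopologicalSpace A] [SeqCompactSpace A]
    (hφ : ∀ x ∈ V, Continuous fun P : A => expectedCost φ x P) : IsCostSeqCompact A V φ := by
  intro u hu
  obtain ⟨P, ψ, hψ, hlim⟩ := SeqCompactSpace.tendsto_subseq fun j => (⟨u j, hu j⟩ : A)
  exact ⟨P, P.2, ψ, hψ, fun x hx => ((hφ x hx).tendsto P).comp hlim⟩

end Minimax

/-! ### Weak limits of integrals of unbounded functions, and tightness. -/

section WeakConvergence

variable {X : Type*} [TopologicalSpace X] [HasOuterApproxClosed X] [MeasurableSpace X]
  [BorelSpace X] {u : ℕ → ProbabilityMeasure X} {P : ProbabilityMeasure X}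

/-- Portmanteau for open sets, applied to superlevel sets, gives lower semicontinuity without
boundedness of `f`. -/
theorem lintegral_le_of_tendsto_probabilityMeasure (hu : Tendsto u atTop (𝓝 P)) {f : X → ℝ}
    (hf : Continuous f) (hf0 : 0 ≤ f) {K : ℝ≥0∞}
    (hK : ∀ j, ∫⁻ x, ENNReal.ofReal (f x) ∂(u j : Measure X) ≤ K) :
    ∫⁻ x, ENNReal.ofReal (f x) ∂(P : Measure X) ≤ K :=
  (lintegral_le_liminf_lintegral_of_forall_isOpen_measure_le_liminf_measure hf hf0 fun _ hG =>
    ProbabilityMeasure.le_liminf_measure_open_of_tendsto hu hG).trans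
    (liminf_le_of_le (by isBoundedDefault) fun b hb => by
      obtain ⟨j, hj⟩ := hb.exists
      exact hj.trans (hK j))

/-- Truncation changes `t` only where |t| > M, and there |t| ^ (1 - s) ≤ M ^ (1 - s) because 1 - s <
0. -/
theorem abs_sub_max_min_le {M s t : ℝ} (hM : 0 < M) (hs : 1 < s) :
    |t - max (-M) (min M t)| ≤ M ^ (1 - s) * |t| ^ s := by
  rcases le_or_gt |t| M with h | h
  · rw [abs_le] at h
    rw [min_eq_right h.2, max_eq_right h.1, sub_self, abs_zero]
    positivity
  · have ht : 0 < |t| := hM.trans h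
    have h1 : |t - max (-M) (min M t)| ≤ |t| := by
      rcases lt_abs.1 h with h | h
      · rw [min_eq_left h.le, max_eq_right (by linarith), abs_of_pos (by linarith),
          abs_of_pos (by linarith)]
        linarith
      · rw [min_eq_right (by linarith), max_eq_left (by linarith), abs_of_neg (by linarith),
          abs_of_neg (by linarith)]
        linarith
    calc _ ≤ |t| := h1
      _ = |t| ^ (1 - s) * |t| ^ s := by rw [← Real.rpow_add ht]; simp
      _ ≤ _ := mul_le_mul_of_nonneg_right
        (Real.rpow_le_rpow_of_nonpos hM h.le (by linarith)) (by positivity)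

theorem abs_integral_sub_integral_max_min_le {X : Type*} [MeasurableSpace X] {μ : Measure X}
    [IsProbabilityMeasure μ] {f : X → ℝ} (hf : Integrable f μ) {M s : ℝ} (hM : 0 < M)
    (hs : 1 < s) {K : ℝ≥0} (hK : ∫⁻ x, ENNReal.ofReal (|f x| ^ s) ∂μ ≤ K) :
    |∫ x, f x ∂μ - ∫ x, max (-M) (min M (f x)) ∂μ| ≤ M ^ (1 - s) * K := by
  have hi : Integrable (fun x => max (-M) (min M (f x))) μ :=
    (integrable_const _).sup ((integrable_const _).inf hf)
  rw [← integral_sub hf hi, ← Real.norm_eq_abs]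
  refine (norm_integral_le_lintegral_norm _).trans
    (ENNReal.toReal_le_of_le_ofReal (by positivity) ?_)
  calc ∫⁻ x, ENNReal.ofReal ‖f x - max (-M) (min M (f x))‖ ∂μ
      ≤ ∫⁻ x, ENNReal.ofReal (M ^ (1 - s)) * ENNReal.ofReal (|f x| ^ s) ∂μ :=
        lintegral_mono fun x => by
          rw [← ENNReal.ofReal_mul (by positivity)]
          exact ENNReal.ofReal_le_ofReal (abs_sub_max_min_le hM hs)
    _ = ENNReal.ofReal (M ^ (1 - s)) * ∫⁻ x, ENNReal.ofReal (|f x| ^ s) ∂μ :=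
        lintegral_const_mul' _ _ ENNReal.ofReal_ne_top
    _ ≤ ENNReal.ofReal (M ^ (1 - s)) * K := by gcongr
    _ = _ := by rw [ENNReal.ofReal_mul (by positivity), ENNReal.ofReal_coe_nnreal]

/-- Weak convergence together with a uniform moment bound of order `s > 1` implies the convergence
of the integrals. -/
theorem tendsto_integral_of_lintegral_rpow_le (hu : Tendsto u atTop (𝓝 P)) {f : X → ℝ}
    (hf : Continuous f) (hfu : ∀ j, Integrable f (u j : Measure X))
    (hfP : Integrable f (P : Measure X)) {s : ℝ} (hs : 1 < s) {K : ℝ≥0}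
    (hK : ∀ j, ∫⁻ x, ENNReal.ofReal (|f x| ^ s) ∂(u j : Measure X) ≤ K) :
    Tendsto (fun j => ∫ x, f x ∂(u j : Measure X)) atTop (𝓝 (∫ x, f x ∂(P : Measure X))) := by
  have hKP : ∫⁻ x, ENNReal.ofReal (|f x| ^ s) ∂(P : Measure X) ≤ K :=
    lintegral_le_of_tendsto_probabilityMeasure hu
      (hf.abs.rpow_const fun _ => Or.inr (by linarith)) (fun x => by positivity) hK
  rw [Metric.tendsto_atTop]
  intro ε hε
  have hlim : Tendsto (fun M : ℝ => M ^ (1 - s) * (K : ℝ)) atTop (𝓝 0) := by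
    have := (tendsto_rpow_neg_atTop (y := s - 1) (by linarith)).mul_const (K : ℝ)
    simpa using this
  -- One truncation level serves all measures, including the limit; the truncated function is
  -- bounded and continuous, so weak convergence applies to it.
  obtain ⟨M, hMε, hM⟩ := ((hlim.eventually (gt_mem_nhds (show 0 < ε / 3 by positivity))).and
    (eventually_gt_atTop 0)).exists
  let T : BoundedContinuousFunction X ℝ := BoundedContinuousFunction.ofNormedAddCommGroup
    (fun x => max (-M) (min M (f x))) (by fun_prop) M fun x => abs_le.2
      ⟨le_max_left _ _, max_le (by linarith) (min_le_left _ _)⟩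
  obtain ⟨N, hN⟩ := Metric.tendsto_atTop.1
    (ProbabilityMeasure.tendsto_iff_forall_integral_tendsto.1 hu T) (ε / 3) (by positivity)
  refine ⟨N, fun j hj => ?_⟩
  have h1 := abs_integral_sub_integral_max_min_le (hfu j) hM hs (hK j)
  have h2 := abs_integral_sub_integral_max_min_le hfP hM hs hKP
  have h3 := hN j hj
  simp only [T, BoundedContinuousFunction.coe_ofNormedAddCommGroup, Real.dist_eq] at h3 ⊢
  rw [abs_le] at h1 h2
  rw [abs_lt] at h3 ⊢
  constructor <;> linarith [h1.1, h1.2, h2.1, h2.2, h3.1, h3.2]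

end WeakConvergence

/-- Markov's inequality outside a closed ball, which is compact in a proper space. -/
theorem isTightMeasureSet_of_lintegral_edist_le {X : Type*} [MetricSpace X] [ProperSpace X]
    [MeasurableSpace X] [BorelSpace X] {s : Set (Measure X)} {x₀ : X} {K : ℝ≥0}
    (hK : ∀ μ ∈ s, ∫⁻ x, edist x₀ x ∂μ ≤ K) : IsTightMeasureSet s := by
  rw [isTightMeasureSet_iff_exists_isCompact_measure_compl_le]
  intro ε hε
  rcases eq_or_ne ε ∞ with rfl | hε'
  · exact ⟨∅, isCompact_empty, fun _ _ => le_top⟩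
  lift ε to ℝ≥0 using hε'
  have hε : 0 < ε := by exact_mod_cast hε
  -- K / ε makes the Markov bound at most ε; the 1 keeps the radius nonzero.
  set R : ℝ≥0 := K / ε + 1
  refine ⟨Metric.closedBall x₀ R, isCompact_closedBall _ _, fun μ hμ => ?_⟩
  have hsub : (Metric.closedBall x₀ (R : ℝ))ᶜ ⊆ {x | (R : ℝ≥0∞) ≤ edist x₀ x} := fun x hx => by
    rw [Set.mem_compl_iff, Metric.mem_closedBall, not_le, dist_comm] at hx
    rw [Set.mem_ofPred_eq, edist_nndist, ENNReal.coe_le_coe]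
    exact_mod_cast hx.le
  have hmk := (mul_meas_ge_le_lintegral (μ := μ) (f := fun x => edist x₀ x) (by fun_prop) R).trans
    (hK μ hμ)
  refine (measure_mono hsub).trans ?_
  have hR : (R : ℝ≥0∞) ≠ 0 := by simp [R]
  have : μ {x | (R : ℝ≥0∞) ≤ edist x₀ x} ≤ K / R :=
    (ENNReal.le_div_iff_mul_le (Or.inl hR) (Or.inl ENNReal.coe_ne_top)).2 (by rwa [mul_comm])
  refine this.trans ?_
  rw [ENNReal.div_le_iff hR ENNReal.coe_ne_top]
  norm_cast
  rw [mul_add, mul_div_cancel₀ _ hε.ne']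
  exact le_self_add

/-! ### Growth and moment estimates; nonemptiness and convexity of the hyperrectangle. -/

section MultiTransport

theorem isProbabilityMeasure_add_smul {X : Type*} [MeasurableSpace X] (μ ν : ProbabilityMeasure X)
    {a b : ℝ≥0} (hab : a + b = 1) :
    IsProbabilityMeasure (a • (μ : Measure X) + b • (ν : Measure X)) := by
  refine ⟨?_⟩
  rw [Measure.add_apply, Measure.smul_apply, Measure.smul_apply, measure_univ, measure_univ,
    ENNReal.smul_def, ENNReal.smul_def, smul_eq_mul, smul_eq_mul, mul_one, mul_one]
  exact_mod_cast hab

variable {n : ℕ} {Ξ : Fin n → Type*} [∀ k, MetricSpace (Ξ k)]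

theorem edist_rpow_le_sum_edist_rpow {p : ℝ} (hp : 0 < p) (ζ ξ : ∀ k, Ξ k) :
    edist ζ ξ ^ p ≤ ∑ k, edist (ζ k) (ξ k) ^ p := by
  rw [← ENNReal.le_rpow_inv_iff hp]
  refine edist_pi_le_iff.2 fun k => ?_
  rw [ENNReal.le_rpow_inv_iff hp]
  exact Finset.single_le_sum (f := fun k => edist (ζ k) (ξ k) ^ p) (fun _ _ => zero_le)
    (Finset.mem_univ k)

theorem IsMetric.nonneg {X : Type*} {ρ : X → X → ℝ} (hρ : IsMetric ρ) (x y : X) : 0 ≤ ρ x y := by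
  have h := hρ.triangle x y x
  rw [(hρ.eq_zero_iff x x).2 rfl, hρ.symm y x] at h
  linarith

/-- A metric equivalent to the product metric is equivalent to the maximum metric. -/
theorem IsEquivProductMetric.exists_dist_le {q : ℝ≥0∞} [Fact (1 ≤ q)]
    {ρ : (∀ k, Ξ k) → (∀ k, Ξ k) → ℝ} (h : IsEquivProductMetric q ρ) :
    ∃ C > 0, ∀ ζ ξ : ∀ k, Ξ k, dist ζ ξ ≤ C * ρ ζ ξ ∧ ρ ζ ξ ≤ C * dist ζ ξ := by
  obtain ⟨c, hc, C, hC, hcC⟩ := h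
  set L : ℝ≥0 := (Fintype.card (Fin n) : ℝ≥0) ^ (1 / q).toReal
  have hL : ∀ ζ ξ : ∀ k, Ξ k, dist (WithLp.toLp q ζ : PiLp q Ξ) (WithLp.toLp q ξ) ≤ L * dist ζ ξ :=
    (PiLp.lipschitzWith_toLp q Ξ).dist_le_mul
  have hl : ∀ ζ ξ : ∀ k, Ξ k, dist ζ ξ ≤ dist (WithLp.toLp q ζ : PiLp q Ξ) (WithLp.toLp q ξ) :=
    fun ζ ξ => by simpa using (PiLp.antilipschitzWith_toLp q Ξ).le_mul_dist ζ ξ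
  refine ⟨1 / c + C * L, by positivity, fun ζ ξ => ?_⟩
  obtain ⟨h1, h2⟩ := hcC ζ ξ
  have hρ : 0 ≤ ρ ζ ξ := le_trans (by positivity) h1
  constructor
  · calc dist ζ ξ ≤ _ := hl ζ ξ
      _ ≤ 1 / c * ρ ζ ξ := by rw [one_div, le_inv_mul_iff₀ hc]; exact h1
      _ ≤ _ := by gcongr; exact le_add_of_nonneg_right (by positivity)
  · calc ρ ζ ξ ≤ C * (L * dist ζ ξ) := h2.trans (by gcongr; exact hL ζ ξ)
      _ = C * L * dist ζ ξ := by ring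
      _ ≤ _ := by gcongr; exact le_add_of_nonneg_left (by positivity)

/-- The triangle inequality moves the base points of both one-sided bounds to the common point `x₀`,
at the price of a constant. -/
theorem exists_abs_le_of_mem_growthClass {X : Type*} [MetricSpace X] {ρ : X → X → ℝ}
    (hρ : ∀ x y, 0 ≤ ρ x y) {C r : ℝ} (hC : 0 < C) (hρC : ∀ x y, ρ x y ≤ C * dist x y)
    (hr : 0 ≤ r) {f : X → ℝ} (hf : f ∈ growthClass ρ r) (x₀ : X) :
    ∃ D > 0, ∀ x, |f x| ≤ D * (1 + dist x₀ x) ^ r := by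
  have key : ∀ g ∈ growthClassUp ρ r, ∃ D > 0, ∀ x, g x ≤ D * (1 + dist x₀ x) ^ r := by
    rintro g ⟨B, hB, ζ, hg⟩
    set a := C * (1 + dist ζ x₀)
    have ha : 0 < a := by positivity
    refine ⟨B * (1 + a ^ r), by positivity, fun x => (hg x).trans ?_⟩
    have h1 : ρ ζ x ≤ a * (1 + dist x₀ x) := by
      have := dist_triangle ζ x₀ x
      calc ρ ζ x ≤ C * dist ζ x := hρC ζ x
        _ ≤ C * ((1 + dist ζ x₀) * (1 + dist x₀ x)) := by
          gcongr
          nlinarith [dist_nonneg (x := ζ) (y := x₀), dist_nonneg (x := x₀) (y := x),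
            mul_nonneg (dist_nonneg (x := ζ) (y := x₀)) (dist_nonneg (x := x₀) (y := x))]
        _ = _ := by ring
    have h2 : ρ ζ x ^ r ≤ a ^ r * (1 + dist x₀ x) ^ r := by
      rw [← Real.mul_rpow ha.le (by positivity)]
      exact Real.rpow_le_rpow (hρ _ _) h1 hr
    have h3 : 1 ≤ (1 + dist x₀ x) ^ r :=
      Real.one_le_rpow (le_add_of_nonneg_right dist_nonneg) hr
    rw [mul_assoc]
    gcongr
    linarith
  obtain ⟨D₁, hD₁, h1⟩ := key f hf.1
  obtain ⟨D₂, hD₂, h2⟩ := key (-f) hf.2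
  refine ⟨max D₁ D₂, lt_max_of_lt_left hD₁, fun x => abs_le'.2 ⟨(h1 x).trans ?_, (h2 x).trans ?_⟩⟩
  · gcongr; exact le_max_left _ _
  · gcongr; exact le_max_right _ _

/-- A function of growth `r < p` has, up to a constant, a power `s > 1` of growth `p`. -/
theorem exists_rpow_abs_le {X : Type*} [MetricSpace X] {f : X → ℝ} {x₀ : X} {D r p : ℝ}
    (hD : 0 < D) (hp : 0 < p) (hrp : r < p) (hf : ∀ x, |f x| ≤ D * (1 + dist x₀ x) ^ r) :
    ∃ s : ℝ, 1 < s ∧ ∀ x, |f x| ^ s ≤ D ^ s * (1 + dist x₀ x) ^ p := by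
  -- Raising the growth order to at least p / 2 keeps it below p and makes the exponent p / t
  -- meaningful when r = 0.
  set t := max r (p / 2)
  have ht : 0 < t := lt_max_of_lt_right (by positivity)
  have htp : t < p := max_lt hrp (by linarith)
  have hs : 0 < p / t := by positivity
  refine ⟨p / t, (one_lt_div ht).2 htp, fun x => ?_⟩
  have h1 : 1 ≤ 1 + dist x₀ x := le_add_of_nonneg_right dist_nonneg
  calc |f x| ^ (p / t) ≤ (D * (1 + dist x₀ x) ^ t) ^ (p / t) := by
        refine Real.rpow_le_rpow (abs_nonneg _) ((hf x).trans ?_) hs.le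
        exact mul_le_mul_of_nonneg_left
          (Real.rpow_le_rpow_of_exponent_le h1 (le_max_left _ _)) hD.le
    _ = _ := by
        rw [Real.mul_rpow hD.le (by positivity), ← Real.rpow_mul (by positivity),
          mul_div_cancel₀ _ ht.ne']

theorem lintegral_one_add_edist_rpow_lt_top {X : Type*} [MetricSpace X] [MeasurableSpace X]
    {ρ : X → X → ℝ} {C p : ℝ} (hC : 0 < C) (hp : 1 ≤ p)
    (hρC : ∀ x y, dist x y ≤ C * ρ x y) {x₀ : X} {Q : ProbabilityMeasure X}
    (hQ : ∫⁻ x, ENNReal.ofReal (ρ x₀ x ^ p) ∂(Q : Measure X) < ∞) :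
    ∫⁻ x, (1 + edist x₀ x) ^ p ∂(Q : Measure X) < ∞ := by
  have hp0 : 0 ≤ p := by linarith
  have hb : ∀ x, (1 + edist x₀ x) ^ p ≤
      2 ^ (p - 1) + 2 ^ (p - 1) * (ENNReal.ofReal C ^ p * ENNReal.ofReal (ρ x₀ x ^ p)) := by
    intro x
    refine (ENNReal.rpow_add_le_mul_rpow_add_rpow _ _ hp).trans ?_
    rw [ENNReal.one_rpow, mul_add, mul_one]
    have hρ : 0 ≤ ρ x₀ x := nonneg_of_mul_nonneg_right (dist_nonneg.trans (hρC x₀ x)) hC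
    gcongr
    rw [← ENNReal.ofReal_rpow_of_nonneg hρ hp0, ← ENNReal.mul_rpow_of_nonneg _ _ hp0,
      ← ENNReal.ofReal_mul hC.le, edist_dist]
    gcongr
    exact hρC x₀ x
  have h2 : (2 : ℝ≥0∞) ^ (p - 1) ≠ ∞ := ENNReal.rpow_ne_top_of_nonneg (by linarith) (by simp)
  refine (lintegral_mono hb).trans_lt ?_
  rw [lintegral_add_left measurable_const, lintegral_const_mul' _ _ h2,
    lintegral_const_mul' _ _ (ENNReal.rpow_ne_top_of_nonneg hp0 ENNReal.ofReal_ne_top)]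
  refine ENNReal.add_lt_top.2 ⟨?_, ENNReal.mul_lt_top h2.lt_top (ENNReal.mul_lt_top
    (ENNReal.rpow_lt_top_of_nonneg hp0 ENNReal.ofReal_ne_top) hQ)⟩
  simpa using h2.lt_top

variable [∀ k, MeasurableSpace (Ξ k)] {p : ℝ} {Q : ProbabilityMeasure (∀ k, Ξ k)} {ε : Fin n → ℝ≥0}

/-- The diagonal coupling has zero transport cost. -/
theorem mem_multiTransportHyperrectangle_self [∀ k, BorelSpace (Ξ k)]
    [∀ k, SecondCountableTopology (Ξ k)] (hp : 0 < p) :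
    Q ∈ multiTransportHyperrectangle p Q ε := by
  have hd : Measurable fun ξ : ∀ k, Ξ k => (ξ, ξ) := by fun_prop
  refine ⟨Q.map hd.aemeasurable, ?_, ?_, fun k => ?_⟩
  · rw [ProbabilityMeasure.toMeasure_map, Measure.map_map measurable_fst hd]
    exact Measure.map_id
  · rw [ProbabilityMeasure.toMeasure_map, Measure.map_map measurable_snd hd]
    exact Measure.map_id
  · rw [ProbabilityMeasure.toMeasure_map, lintegral_map (by fun_prop) hd]
    simp [hp]

theorem isConvexAmbiguitySet_multiTransportHyperrectangle :
    IsConvexAmbiguitySet (multiTransportHyperrectangle p Q ε) := by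
  rintro _ ⟨P₁, ⟨π₁, h1Q, h1P, h1⟩, rfl⟩ _ ⟨P₂, ⟨π₂, h2Q, h2P, h2⟩, rfl⟩ a b ha hb hab
  refine ⟨⟨_, isProbabilityMeasure_add_smul P₁ P₂ hab⟩,
    ⟨⟨_, isProbabilityMeasure_add_smul π₁ π₂ hab⟩, ?_, ?_, fun k => ?_⟩, rfl⟩
  · simp only [ProbabilityMeasure.coe_mk]
    rw [Measure.map_add _ _ measurable_fst, Measure.map_smul, Measure.map_smul, h1Q, h2Q,
      ← add_smul, hab, one_smul]
  · simp only [ProbabilityMeasure.coe_mk]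
    rw [Measure.map_add _ _ measurable_snd, Measure.map_smul, Measure.map_smul, h1P, h2P]
  · simp only [ProbabilityMeasure.coe_mk]
    rw [lintegral_add_measure, lintegral_smul_measure, lintegral_smul_measure]
    calc _ ≤ a • ((ε k : ℝ≥0∞) ^ p) + b • ((ε k : ℝ≥0∞) ^ p) := by
          gcongr <;> [exact h1 k; exact h2 k]
      _ = _ := by rw [← add_smul, hab, one_smul]

/-! ### Sequential compactness of the hyperrectangle. -/

variable [∀ k, ProperSpace (Ξ k)] [∀ k, BorelSpace (Ξ k)]

/-- The triangle inequality through the first coordinate bounds the moments of all second marginals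
uniformly, by the moment of `Q` and the transport budgets. -/
theorem lintegral_one_add_edist_snd_rpow_le {π : Measure ((∀ k, Ξ k) × (∀ k, Ξ k))}
    (hp : 1 ≤ p) (hπ : π.map Prod.fst = Q)
    (hc : ∀ k, ∫⁻ z, edist (z.1 k) (z.2 k) ^ p ∂π ≤ (ε k : ℝ≥0∞) ^ p) (x₀ : ∀ k, Ξ k) :
    ∫⁻ z, (1 + edist x₀ z.2) ^ p ∂π ≤
      2 ^ (p - 1) * (∫⁻ ξ, (1 + edist x₀ ξ) ^ p ∂(Q : Measure (∀ k, Ξ k)) +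
        ∑ k, (ε k : ℝ≥0∞) ^ p) := by
  have hp0 : 0 < p := by linarith
  calc ∫⁻ z, (1 + edist x₀ z.2) ^ p ∂π
      ≤ ∫⁻ z, 2 ^ (p - 1) * ((1 + edist x₀ z.1) ^ p + ∑ k, edist (z.1 k) (z.2 k) ^ p) ∂π := by
        refine lintegral_mono fun z => ?_
        refine le_trans ?_ ((ENNReal.rpow_add_le_mul_rpow_add_rpow _ (edist z.1 z.2) hp).trans
          (mul_le_mul_right (add_le_add_right (edist_rpow_le_sum_edist_rpow hp0 _ _) _) _))
        refine ENNReal.rpow_le_rpow ?_ hp0.le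
        rw [add_assoc]
        exact add_le_add_right (edist_triangle _ _ _) _
    _ = 2 ^ (p - 1) * (∫⁻ z, (1 + edist x₀ z.1) ^ p ∂π +
          ∑ k, ∫⁻ z, edist (z.1 k) (z.2 k) ^ p ∂π) := by
        rw [lintegral_const_mul _ (by fun_prop), lintegral_add_left (by fun_prop),
          lintegral_finsetSum _ (by fun_prop)]
    _ ≤ _ := by
        rw [← hπ, lintegral_map (by fun_prop) measurable_fst]
        gcongr with k
        exact hc k

/-- Limits are extracted for the couplings, not for their second marginals, so that the limit comes
with a witness of its own membership. -/
theorem isCostSeqCompact_multiTransportHyperrectangle {E : Type*} {V : Set E}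
    {φ : E → (∀ k, Ξ k) → ℝ} {r : ℝ} {x₀ : ∀ k, Ξ k} (hp : 1 ≤ p) (hrp : r < p)
    (hQ : ∫⁻ ξ, (1 + edist x₀ ξ) ^ p ∂(Q : Measure (∀ k, Ξ k)) < ∞)
    (hcont : ∀ x ∈ V, Continuous (φ x))
    (hgrowth : ∀ x ∈ V, ∃ D > 0, ∀ ξ, |φ x ξ| ≤ D * (1 + dist x₀ ξ) ^ r)
    (hint : ∀ x ∈ V, ∀ P ∈ multiTransportHyperrectangle p Q ε,
      Integrable (φ x) (P : Measure (∀ k, Ξ k))) :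
    IsCostSeqCompact (multiTransportHyperrectangle p Q ε) V φ := by
  have hp0 : 0 < p := by linarith
  intro u hu
  choose π hπQ hπu hπc using hu
  set I := ∫⁻ ξ, (1 + edist x₀ ξ) ^ p ∂(Q : Measure (∀ k, Ξ k))
  set K : ℝ≥0∞ := 2 ^ (p - 1) * (I + ∑ k, (ε k : ℝ≥0∞) ^ p)
  have hK : K < ∞ := by
    refine ENNReal.mul_lt_top (ENNReal.rpow_lt_top_of_nonneg (by linarith) (by simp))
      (ENNReal.add_lt_top.2 ⟨hQ, ENNReal.sum_lt_top.2 fun k _ => ?_⟩)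
    exact ENNReal.rpow_lt_top_of_nonneg hp0.le ENNReal.coe_ne_top
  have hmom : ∀ j, ∫⁻ z, (1 + edist x₀ z.2) ^ p ∂(π j : Measure ((∀ k, Ξ k) × (∀ k, Ξ k))) ≤ K :=
    fun j => lintegral_one_add_edist_snd_rpow_le hp (hπQ j) (hπc j) x₀
  have hle : ∀ ξ, edist x₀ ξ ≤ (1 + edist x₀ ξ) ^ p := fun ξ =>
    le_add_self.trans (ENNReal.le_rpow_self_of_one_le le_self_add hp)
  have htight : IsTightMeasureSet
      {((μ : ProbabilityMeasure _) : Measure ((∀ k, Ξ k) × (∀ k, Ξ k))) | μ ∈ Set.range π} := by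
    refine isTightMeasureSet_of_lintegral_edist_le (x₀ := (x₀, x₀)) (K := (I + K).toNNReal) ?_
    rintro _ ⟨_, ⟨j, rfl⟩, rfl⟩
    rw [ENNReal.coe_toNNReal (ENNReal.add_lt_top.2 ⟨hQ, hK⟩).ne]
    calc ∫⁻ z, edist (x₀, x₀) z ∂(π j : Measure ((∀ k, Ξ k) × (∀ k, Ξ k)))
        ≤ ∫⁻ z, (1 + edist x₀ z.1) ^ p + (1 + edist x₀ z.2) ^ p
          ∂(π j : Measure ((∀ k, Ξ k) × (∀ k, Ξ k))) := by
          refine lintegral_mono fun z => ?_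
          rw [Prod.edist_eq]
          exact max_le ((hle _).trans le_self_add) ((hle _).trans le_add_self)
      _ = I + ∫⁻ z, (1 + edist x₀ z.2) ^ p
          ∂(π j : Measure ((∀ k, Ξ k) × (∀ k, Ξ k))) := by
          rw [lintegral_add_left (by fun_prop)]
          simp only [I]
          rw [← hπQ j, lintegral_map (by fun_prop) measurable_fst]
      _ ≤ I + K := by gcongr; exact hmom j
  -- Membership of the limit in the closure is dropped: its marginal and cost constraints are
  -- checked directly.
  obtain ⟨π', -, ψ, hψ, hlim⟩ := (isCompact_closure_of_isTightMeasureSet htight).isSeqCompact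
    fun j => subset_closure (Set.mem_range_self j)
  have hfst := ProbabilityMeasure.tendsto_map_of_tendsto_of_continuous _ _ hlim continuous_fst
  have hsnd := ProbabilityMeasure.tendsto_map_of_tendsto_of_continuous _ _ hlim continuous_snd
  have hfst' : ∀ j, (π (ψ j)).map continuous_fst.measurable.aemeasurable = Q := fun j =>
    Subtype.ext (hπQ (ψ j))
  have hsnd' : ∀ j, (π (ψ j)).map continuous_snd.measurable.aemeasurable = u (ψ j) := fun j =>
    Subtype.ext (hπu (ψ j))
  simp only [Function.comp_apply, hfst'] at hfst
  simp only [Function.comp_apply, hsnd'] at hsnd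
  have hQ' := tendsto_nhds_unique hfst tendsto_const_nhds
  have hmem : π'.map continuous_snd.measurable.aemeasurable ∈
      multiTransportHyperrectangle p Q ε := by
    refine ⟨π', congrArg ProbabilityMeasure.toMeasure hQ', rfl, fun k => ?_⟩
    have he : ∀ z : (∀ k, Ξ k) × (∀ k, Ξ k), edist (z.1 k) (z.2 k) ^ p =
        ENNReal.ofReal (dist (z.1 k) (z.2 k) ^ p) := fun z => by
      rw [edist_dist, ENNReal.ofReal_rpow_of_nonneg dist_nonneg hp0.le]
    have hk : ∀ j, _ := fun j => hπc (ψ j) k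
    simp only [he] at hk ⊢
    exact lintegral_le_of_tendsto_probabilityMeasure hlim
      (Continuous.rpow_const (by fun_prop) fun _ => Or.inr hp0.le) (fun _ => by positivity) hk
  refine ⟨_, hmem, ψ, hψ, fun x hx => ?_⟩
  obtain ⟨D, hD, hφ⟩ := hgrowth x hx
  obtain ⟨s, hs, hφs⟩ := exists_rpow_abs_le hD hp0 hrp hφ
  have humem : ∀ j, u j ∈ multiTransportHyperrectangle p Q ε := fun j =>
    ⟨π j, hπQ j, hπu j, hπc j⟩
  refine tendsto_integral_of_lintegral_rpow_le (K := (ENNReal.ofReal (D ^ s) * K).toNNReal) hsnd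
    (hcont x hx) (fun j => hint x hx _ (humem _)) (hint x hx _ hmem) hs fun j => ?_
  rw [ENNReal.coe_toNNReal (ENNReal.mul_lt_top ENNReal.ofReal_lt_top hK).ne]
  calc ∫⁻ ξ, ENNReal.ofReal (|φ x ξ| ^ s) ∂(u (ψ j) : Measure (∀ k, Ξ k))
      ≤ ∫⁻ ξ, ENNReal.ofReal (D ^ s) * (1 + edist x₀ ξ) ^ p ∂(u (ψ j) : Measure (∀ k, Ξ k)) := by
        refine lintegral_mono fun ξ => ?_
        rw [edist_dist, ← ENNReal.ofReal_one, ← ENNReal.ofReal_add zero_le_one dist_nonneg,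
          ENNReal.ofReal_rpow_of_nonneg (by positivity) hp0.le,
          ← ENNReal.ofReal_mul (by positivity)]
        exact ENNReal.ofReal_le_ofReal (hφs ξ)
    _ = ENNReal.ofReal (D ^ s) * ∫⁻ z, (1 + edist x₀ z.2) ^ p
          ∂(π (ψ j) : Measure ((∀ k, Ξ k) × (∀ k, Ξ k))) := by
        rw [lintegral_const_mul' _ _ ENNReal.ofReal_ne_top, ← hπu (ψ j),
          lintegral_map (by fun_prop) measurable_snd]
    _ ≤ _ := by gcongr; exact hmom _

end MultiTransport

end SaddlePoints

/-- First part: general ambiguity sets with an arbitrary topology. Second part: multi-transport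
hyperrectangles. The topology and the Borel σ-algebra on the product `∀ k, Ξ k` are the product
ones; these are the ones induced by `ρ`, which is equivalent to the product metric. -/
theorem mainTheorem12 {d : ℕ} (S V : Set (EuclideanSpace ℝ (Fin d)))
    (hS_closed : IsClosed S) (hS_convex : Convex ℝ S)
    (hV_convex : Convex ℝ V) (hV_nhds : V ∈ 𝓝ˢ S)
    (xbar : EuclideanSpace ℝ (Fin d)) :
    (∀ {Ξ : Type*} [MeasurableSpace Ξ] (A : Set (ProbabilityMeasure Ξ)) [TopologicalSpace A]
        (φ : EuclideanSpace ℝ (Fin d) → Ξ → ℝ),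
      A.Nonempty → IsConvexAmbiguitySet A →
      IsSaddleFunction A V φ →
      SeqCompactSpace A →
      (∀ x ∈ V, Continuous fun P : A => expectedCost φ x P) →
      IsOptimalSolution A S φ xbar →
      (∃ Pbar ∈ A, IsSaddlePointOn S A (expectedCost φ) xbar Pbar) ∧
        MinimaxEquality A S φ) ∧
    (∀ {n : ℕ} {Ξ : Fin n → Type*} [∀ k, MetricSpace (Ξ k)] [∀ k, ProperSpace (Ξ k)]
        [∀ k, MeasurableSpace (Ξ k)] [∀ k, BorelSpace (Ξ k)]
        (q : ℝ≥0∞) [Fact (1 ≤ q)] (ρ : (∀ k, Ξ k) → (∀ k, Ξ k) → ℝ) (p r : ℝ)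
        (Q : ProbabilityMeasure (∀ k, Ξ k)) (ε : Fin n → ℝ≥0)
        (φ : EuclideanSpace ℝ (Fin d) → (∀ k, Ξ k) → ℝ),
      IsMetric ρ → IsEquivProductMetric q ρ →
      1 ≤ p → HasFiniteMoment ρ p Q →
      0 ≤ r → r < p →
      (∀ x ∈ V, Continuous (φ x) ∧ φ x ∈ growthClass ρ r) →
      IsSaddleFunction (multiTransportHyperrectangle p Q ε) V φ →
      IsOptimalSolution (multiTransportHyperrectangle p Q ε) S φ xbar →
      (∃ Pbar ∈ multiTransportHyperrectangle p Q ε,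
        IsSaddlePointOn S (multiTransportHyperrectangle p Q ε) (expectedCost φ) xbar Pbar) ∧
        MinimaxEquality (multiTransportHyperrectangle p Q ε) S φ) := by
  refine ⟨?_, ?_⟩
  · intro Ξ _ A _ φ hne hA hφ _ hc hx
    exact exists_isSaddlePointOn_of_isCostSeqCompact hS_convex hV_convex hV_nhds hne hA hφ
      (isCostSeqCompact_of_seqCompactSpace hc) hx
  · intro n Ξ _ _ _ _ q _ ρ p r Q ε φ hρ hρq hp hQ hr hrp hφc hφ hx
    obtain ⟨C, hC, hρC⟩ := hρq.exists_dist_le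
    obtain ⟨x₀, hx₀⟩ := hQ
    exact exists_isSaddlePointOn_of_isCostSeqCompact hS_convex hV_convex hV_nhds
      ⟨Q, mem_multiTransportHyperrectangle_self (by linarith)⟩
      isConvexAmbiguitySet_multiTransportHyperrectangle hφ
      (isCostSeqCompact_multiTransportHyperrectangle hp hrp
        (lintegral_one_add_edist_rpow_lt_top hC hp (fun x y => (hρC x y).1) hx₀)
        (fun x hx => (hφc x hx).1)
        (fun x hx => exists_abs_le_of_mem_growthClass hρ.nonneg hC (fun x y => (hρC x y).2) hr
          (hφc x hx).2 x₀)
        hφ.integrable) hx
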